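/- Let $\Lambda^1$ be the 4-dimensional real vector space with basis $\gamma_0,\dots,\gamma_3$ and Minkowski scalar product $\gamma_\mu\cdot\gamma_\nu=\mathrm{diag}(1,-1,-1,-1)$, let $\gamma^\mu$ be the reciprocal basis ($\gamma^\mu\cdot\gamma_\nu=\delta^\mu_\nu$), and let $\mathcal{C}\ell(1,3)$ be its Clifford algebra, whose elements are called multiforms. Points of Minkowski spacetime are identified with $x=x^\mu\gamma_\mu\in\Lambda^1$. Let $U\subseteq\Lambda^1$ be open and let $h$ be a smooth field on $U$ of invertible linear maps $h_x:\Lambda^1\to\Lambda^1$; put $h^{*}=(h^{-1})^{\dagger}$, where $\dagger$ is the adjoint with respect to the Minkowski scalar product. Let $D$ be the Levi-Civita connection of the metric $g(a,b)=h(a)\cdot h(b)$, put $\mathcal{D}_a n=h(D_a(h^{-1}(n)))$ for fields $n$ with values in $\Lambda^1$, and let $\Omega(a)=-\tfrac12\sum_\mu\gamma^\mu\wedge\mathcal{D}_a\gamma_\mu$ be its connection 2-form, so that $\mathcal{D}_an=a\cdot\partial n+\tfrac12(\Omega(a)n-n\Omega(a))$. For a multiform field $\varphi$ define the gauge spinor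 derivative $$\mathcal{D}^s\varphi=\sum_{\mu}h^{*}(\gamma^\mu)\left(\gamma_\mu\cdot\partial\varphi+\tfrac12\,\Omega(\gamma_\mu)\varphi\right),$$ where $a\cdot\partial$ is the directional derivative along $a$ and the products are Clifford products. Let $\psi$ be a smooth Dirac–Hestenes spinor field on $U$, i.e. a smooth field with values in the even multiforms $\Lambda^0+\Lambda^2+\Lambda^4$ (then $\mathcal{D}^s\psi$ is odd), and let $\ell(x,X,Y)$ be a real-valued function of a point $x$, an even multiform $X$ and an odd multiform $Y$ which is $C^2$ near every $(x,\psi(x),\mathcal{D}^s\psi(x))$, $x\in U$ (in particular $\ell$ may be independent of $x$). Put $\mathcal{L}=\det(h)\,\ell$. Let $\partial_\psi\ell$ and $\partial_{\mathcal{D}^s\psi}\ell$ denote the multiform derivatives of $\ell$ with respect to $X$ and $Y$ at $(x,\psi(x),\mathcal{D}^s\psi(x))$, that is $\sum_I\gamma^I\,(d\ell)(\gamma_I)$, where $d\ell$ is the differential of $\ell$ in the variable concerned, $I=\{i_1<\dots<i_k\}$ runs over the index sets with $k$ even, respectively odd, $\gamma_I=\gamma_{i_1}\cdots\gamma_{i_k}$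 and $\gamma^I=\gamma^{i_1}\cdots\gamma^{i_k}$. Suppose that the action is stationary at $\psi$, in the sense that $$\int_U\left.\frac{d}{d\lambda}\,\mathcal{L}\bigl(x,\psi+\lambda\eta,\mathcal{D}^s\psi+\lambda\mathcal{D}^s\eta\bigr)\right|_{\lambda=0}d^4x=0$$ for all smooth compactly supported fields $\eta$ on $\Lambda^1$ with values in the even multiforms such that $\eta=0$ on $\partial U$. Then on $U$ $$\partial_\psi\ell(x,\psi,\mathcal{D}^s\psi)-\mathcal{D}^s\bigl(\partial_{\mathcal{D}^s\psi}\ell(x,\psi,\mathcal{D}^s\psi)\bigr)=0 .$$ -/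

import Mathlib

open MeasureTheory
open scoped ContDiff

noncomputable section

namespace GaugeSpinor

/-! ### Minkowski space and the spacetime algebra -/

/-- The Minkowski vector space of 1-forms, in coordinates with respect to the orthonormal basis
`γ_μ`.  A point of spacetime is identified with its position form `x = x^μ γ_μ`, so this is also
spacetime itself, and `d⁴x` is Lebesgue measure. -/
abbrev Form1 : Type := Fin 4 → ℝ

/-- The diagonal `(1, -1, -1, -1)` of the Minkowski metric. -/
def sig : Fin 4 → ℝ := ![1, -1, -1, -1]

/-- The scalar product `a · b` of 1-forms. -/
def mdot (a b : Form1) : ℝ := ∑ μ, sig μ * a μ * b μ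

/-- The quadratic form `a ↦ a · a`. -/
def minkQ : QuadraticForm ℝ Form1 := QuadraticMap.weightedSumSquares ℝ sig

/-- The basis 1-form `γ_μ`. -/
def lo (μ : Fin 4) : Form1 := Pi.single μ 1

/-- The reciprocal basis 1-form `γ^μ`, so that `γ^μ · γ_ν = δ^μ_ν`. -/
def up (μ : Fin 4) : Form1 := sig μ • lo μ

/-- The spacetime algebra `Cℓ(1,3)` (multiforms with the Clifford product). -/
abbrev STA : Type := CliffordAlgebra minkQ

/-- The inclusion of 1-forms in the spacetime algebra. -/
abbrev vec (a : Form1) : STA := CliffordAlgebra.ι minkQ a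

/-- The components of a multiform in the basis of exterior products of the `γ_μ`. -/
def components : STA ≃ₗ[ℝ] (Finset (Fin 4) → ℝ) :=
  (CliffordAlgebra.equivExterior minkQ).trans (Pi.basisFun ℝ (Fin 4)).ExteriorAlgebra.equivFun

/-- The largest absolute value of a component as a norm.  The space is finite-dimensional, so
smoothness and derivatives of multiform fields do not depend on the choice of the norm. -/
instance instNormedAddCommGroupSTA : NormedAddCommGroup STA :=
  NormedAddCommGroup.induced STA (Finset (Fin 4) → ℝ) components components.injective

instance instNormedSpaceSTA : NormedSpace ℝ STA :=
  NormedSpace.induced ℝ STA (Finset (Fin 4) → ℝ) components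

/-- The multiforms of even grade, `Λ⁰ + Λ² + Λ⁴`. -/
abbrev evenPart : Submodule ℝ STA := CliffordAlgebra.evenOdd minkQ 0

/-- The exterior product `a ∧ b` of two 1-forms, as an element of the spacetime algebra. -/
def wedge (a b : Form1) : STA := (1 / 2 : ℝ) • (vec a * vec b - vec b * vec a)

/-! ### The gauge metric extensor and its connection -/

/-- The adjoint `t†` of a (1,1)-extensor with respect to the Minkowski scalar product:
`t†(a) · b = a · t(b)`. -/
def adj (t : Form1 →L[ℝ] Form1) (a : Form1) : Form1 := ∑ μ, mdot a (t (lo μ)) • up μ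

/-- `h^* = (h⁻¹)†`. -/
def hstar (h : Form1 → Form1 →L[ℝ] Form1) (x a : Form1) : Form1 := adj (h x).inverse a

/-- The metric `g = h†h`, i.e. `g_x(a, b) = h_x(a) · h_x(b)`. -/
def metric (h : Form1 → Form1 →L[ℝ] Form1) (x a b : Form1) : ℝ := mdot (h x a) (h x b)

/-- The Christoffel symbols of the first kind of `g`: for constant `a, b, c`,
`½ (a·∂ g(b,c) + b·∂ g(a,c) - c·∂ g(a,b))`. -/
def christoffelLower (h : Form1 → Form1 →L[ℝ] Form1) (x a b c : Form1) : ℝ :=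
  (1 / 2 : ℝ) * (fderiv ℝ (fun y => metric h y b c) x a + fderiv ℝ (fun y => metric h y a c) x b
    - fderiv ℝ (fun y => metric h y a b) x c)

/-- The Christoffel symbols of the second kind, obtained by raising the last index with
`g⁻¹ = h⁻¹ h^*`. -/
def christoffel (h : Form1 → Form1 →L[ℝ] Form1) (x a b : Form1) : Form1 :=
  ∑ μ, christoffelLower h x a b (lo μ) • (h x).inverse (hstar h x (up μ))

/-- The Levi-Civita directional covariant derivative `D_a v` of the metric `g = h†h`. -/
def leviCivita (h : Form1 → Form1 →L[ℝ] Form1) (a : Form1) (v : Form1 → Form1) (x : Form1) :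
    Form1 :=
  fderiv ℝ v x a + christoffel h x a (v x)

/-- The gauge covariant derivative of a 1-form field, `𝒟_a n = h(D_a (h⁻¹(n)))`. -/
def gaugeDeriv (h : Form1 → Form1 →L[ℝ] Form1) (a : Form1) (n : Form1 → Form1) (x : Form1) :
    Form1 :=
  h x (leviCivita h a (fun y => (h y).inverse (n y)) x)

/-- The connection extensor `Ω_x(a) = -½ ∂_n ∧ 𝒟_a n = -½ γ^μ ∧ 𝒟_a γ_μ`, a 2-form.  It is
the one for which `𝒟_a n = a·∂ n + Ω(a) × n`. -/
def Omega (h : Form1 → Form1 →L[ℝ] Form1) (x a : Form1) : STA :=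
  -(1 / 2 : ℝ) • ∑ μ, wedge (up μ) (gaugeDeriv h a (fun _ => lo μ) x)

/-- The directional spinor derivative `𝒟^s_a ψ = a·∂ψ + ½ Ω(a) ψ`. -/
def spinorDirDeriv (h : Form1 → Form1 →L[ℝ] Form1) (a : Form1) (ψ : Form1 → STA) (x : Form1) :
    STA :=
  fderiv ℝ ψ x a + (1 / 2 : ℝ) • (Omega h x a * ψ x)

/-- The gauge spinor derivative `𝒟^s ψ = h^*(∂_a) 𝒟^s_a ψ = h^*(γ^μ) 𝒟^s_{γ_μ} ψ`. -/
def spinorDeriv (h : Form1 → Form1 →L[ℝ] Form1) (ψ : Form1 → STA) (x : Form1) : STA :=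
  ∑ μ, vec (hstar h x (up μ)) * spinorDirDeriv h (lo μ) ψ x

/-! ### Multiform derivatives -/

/-- The basis multiform `γ_I = γ_{i₁} ⋯ γ_{i_k}` for `I = {i₁ < ⋯ < i_k}`. -/
def blade (I : Finset (Fin 4)) : STA := ((I.sort (· ≤ ·)).map fun μ => vec (lo μ)).prod

/-- The reciprocal basis multiform `γ^I = γ^{i₁} ⋯ γ^{i_k}`; with the scalar product
`X · Y = ⟨X Ỹ⟩₀` one has `γ^I · γ_J = δ^I_J`. -/
def recBlade (I : Finset (Fin 4)) : STA := ((I.sort (· ≤ ·)).map fun μ => vec (up μ)).prod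

/-- The multiform derivative `∂_X f = ∑_I γ^I (γ_I · ∂_X) f`, where `(A · ∂_X) f` is the derivative
of `f` in the direction `A`, with respect to a variable `X` whose grades are even. -/
def gradEven (f : STA → ℝ) (X : STA) : STA :=
  ∑ I with Even I.card, fderiv ℝ f X (blade I) • recBlade I

/-- The multiform derivative `∂_Y f` with respect to a variable `Y` whose grades are odd. -/
def gradOdd (f : STA → ℝ) (Y : STA) : STA :=
  ∑ I with Odd I.card, fderiv ℝ f Y (blade I) • recBlade I

/-! ### The variational principle -/

/-- The Lagrangian `𝓛 = det(h) ℓ`.  The function `ℓ` may depend explicitly on the spacetime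
point (through external fields). -/
def lagrangian (h : Form1 → Form1 →L[ℝ] Form1) (l : Form1 × STA × STA → ℝ) (x : Form1)
    (X Y : STA) : ℝ :=
  (h x).det * l (x, X, Y)

/-- The variation `δ_ψ 𝓛 = d/dt 𝓛(ψ + t η, 𝒟^sψ + t 𝒟^sη)` at `t = 0`. -/
def variation (h : Form1 → Form1 →L[ℝ] Form1) (l : Form1 × STA × STA → ℝ)
    (ψ η : Form1 → STA) (x : Form1) : ℝ :=
  deriv (fun t : ℝ =>
    lagrangian h l x (ψ x + t • η x) (spinorDeriv h ψ x + t • spinorDeriv h η x)) 0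

/-- The condition of stationary action on `U`: `∫_U δ_ψ 𝓛 d⁴x = 0` for all smooth even fields `η`
that vanish on `∂U`.  The compact support of `η` is no restriction when `U` is bounded; when `U`
is unbounded it makes the condition weaker. -/
def StationaryAction (U : Set Form1) (h : Form1 → Form1 →L[ℝ] Form1)
    (l : Form1 × STA × STA → ℝ) (ψ : Form1 → STA) : Prop :=
  ∀ η : Form1 → STA, ContDiff ℝ ∞ η → HasCompactSupport η → (∀ x, η x ∈ evenPart) →
    (∀ x ∈ frontier U, η x = 0) → ∫ x in U, variation h l ψ η x = 0

end GaugeSpinor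

end

/-!
The point is that `𝒟^s` is formally self-adjoint for `det(h) d⁴x`, up to a divergence: with the
scalar product `⟨X̃ Y⟩₀`,
`∑_μ ∂_μ (det(h) ⟨h^*(γ^μ) P, η⟩) = det(h) (⟨𝒟^s P, η⟩ + ⟨P, 𝒟^s η⟩)`.
Differentiating the product leaves the terms with `∑_μ ∂_μ (det(h) h^*(γ^μ))`. As the Levi-Civita
connection is torsion-free, this vector equals `-det(h) ∑_μ 𝒟_{γ_μ} h^*(γ^μ)`, the fields
`h^*(γ^μ)` being frozen at the point, and as the connection is metric, `𝒟_a` acts on constant fields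
as half the commutator with the 2-form `Ω(a)`. Since `Ω(a)` changes sign under reversion, the two
halves of the commutator supply exactly the connection terms of `𝒟^s P` and of `𝒟^s η`.

With `P = ∂_{𝒟^sψ} ℓ`, the variation of `𝓛` is therefore `det(h) ⟨∂_ψ ℓ - 𝒟^s P, η⟩` plus a
divergence. The fundamental lemma of the calculus of variations, applied to `η = φ B` with `B` an
even constant, shows that the even field `∂_ψ ℓ - 𝒟^s P` is orthogonal to all even multiforms.
-/

noncomputable section

namespace GaugeSpinor

section Multiplication

variable {ι R A : Type*}

lemma mul_prod_map_of_anticommute [DecidableEq ι] [Ring A] {f : ι → A} {g : A} {i : ι}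
    (hcomm : Commute g (f i)) (hanti : ∀ j, j ≠ i → g * f j = -(f j * g)) (L : List ι) :
    g * (L.map f).prod = (-1) ^ (L.length + L.count i) * ((L.map f).prod * g) := by
  induction L with
  | nil => simp
  | cons j L ih =>
    have hsign : ∀ n : ℕ, f j * ((-1) ^ n * ((L.map f).prod * g))
        = (-1) ^ n * (f j * (L.map f).prod * g) := fun n => by
      rw [← mul_assoc, ((Commute.neg_one_right (f j)).pow_right n).eq, mul_assoc, mul_assoc]
    rw [List.map_cons, List.prod_cons, List.length_cons, ← mul_assoc]
    by_cases h : j = i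
    · subst h
      rw [hcomm.eq, mul_assoc, ih, hsign, List.count_cons_self,
        show L.length + 1 + (L.count j + 1) = L.length + L.count j + 2 by ring,
        pow_add _ _ 2, neg_one_sq, mul_one]
    · rw [hanti j h, neg_mul, mul_assoc, ih, hsign, List.count_cons_of_ne h, add_right_comm,
        pow_succ', neg_one_mul, neg_mul]

lemma prod_map_reverse_mul_prod_map [Monoid A] {f g : ι → A} (h : ∀ i, f i * g i = 1)
    (L : List ι) : (L.reverse.map f).prod * (L.map g).prod = 1 := by
  induction L with
  | nil => simp
  | cons i L ih =>
    rw [List.reverse_cons, List.map_append, List.prod_append, List.map_singleton,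
      List.prod_singleton, List.map_cons, List.prod_cons, mul_assoc, ← mul_assoc (f i), h,
      one_mul, ih]

lemma trace_eq_zero_of_conj_eq_neg {V : Type*} [Field R] [NeZero (2 : R)] [AddCommGroup V]
    [Module R V] {f : V →ₗ[R] V} {e : V ≃ₗ[R] V} (h : e.conj f = -f) :
    LinearMap.trace R V f = 0 := by
  have htrace := LinearMap.trace_conj' f e
  rw [h, map_neg] at htrace
  have : (2 : R) * LinearMap.trace R V f = 0 := by linear_combination -htrace
  exact (mul_eq_zero.1 this).resolve_left two_ne_zero

lemma trace_mulLeft_eq_zero_of_anticommute [Field R] [NeZero (2 : R)] [Ring A] [Algebra R A]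
    {X e : A} (he : IsUnit e) (h : e * X = -(X * e)) :
    LinearMap.trace R A (LinearMap.mulLeft R X) = 0 := by
  obtain ⟨u, rfl⟩ := he
  refine trace_eq_zero_of_conj_eq_neg (e := DistribMulAction.toLinearEquiv R A u) ?_
  ext Y
  change (u : A) * (X * ((u⁻¹ : Aˣ) * Y)) = -(X * Y)
  rw [← mul_assoc, h, neg_mul, mul_assoc, Units.mul_inv_cancel_left]

lemma trace_mulLeft_eq_zero_of_mem_odd {M : Type*} [Field R] [NeZero (2 : R)] [AddCommGroup M]
    [Module R M] {Q : QuadraticForm R M} {X : CliffordAlgebra Q}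
    (hX : X ∈ CliffordAlgebra.evenOdd Q 1) :
    LinearMap.trace R (CliffordAlgebra Q) (LinearMap.mulLeft R X) = 0 := by
  refine trace_eq_zero_of_conj_eq_neg
    (e := (CliffordAlgebra.involuteEquiv (Q := Q)).toLinearEquiv) (LinearMap.ext fun Y => ?_)
  simp [LinearEquiv.conj_apply, CliffordAlgebra.involute_eq_of_mem_odd hX]

lemma sum_apply_smul_of_biorthogonal {V : Type*} [Field R] [AddCommGroup V] [Module R V]
    [FiniteDimensional R V] [Fintype ι] [DecidableEq ι] {e : ι → V} {ε : ι → Module.Dual R V}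
    (h : ∀ i j, ε i (e j) = if i = j then 1 else 0)
    (hcard : Module.finrank R V = Fintype.card ι) (x : V) : ∑ i, ε i x • e i = x := by
  have hsurj : Function.Surjective (LinearMap.pi ε) := fun c =>
    ⟨∑ j, c j • e j, funext fun i => by simp [h]⟩
  have hinj : Function.Injective (LinearMap.pi ε) :=
    (LinearMap.injective_iff_surjective_of_finrank_eq_finrank (by simpa using hcard)).2 hsurj
  exact hinj (funext fun i => by simp [h])

end Multiplication

section Minkowski

lemma mdot_comm (a b : Form1) : mdot a b = mdot b a := by
  simp only [mdot, mul_right_comm]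

/-- The Minkowski scalar product as a continuous bilinear map. -/
def mdotL : Form1 →L[ℝ] Form1 →L[ℝ] ℝ :=
  have hadd (a b c : Form1) : mdot (a + b) c = mdot a c + mdot b c := by
    simp only [mdot, Pi.add_apply, mul_add, add_mul, Finset.sum_add_distrib]
  have hsmul (r : ℝ) (a b : Form1) : mdot (r • a) b = r • mdot a b := by
    simp only [mdot, Pi.smul_apply, smul_eq_mul, Finset.mul_sum, mul_left_comm, mul_assoc]
  (LinearMap.mk₂ ℝ mdot hadd hsmul
    (fun a b c => by rw [mdot_comm, hadd, mdot_comm b, mdot_comm c])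
    (fun r a b => by rw [mdot_comm, hsmul, mdot_comm b])).toContinuousBilinearMap

lemma mdotL_apply (a b : Form1) : mdotL a b = mdot a b := rfl

lemma sig_mul_self (μ : Fin 4) : sig μ * sig μ = 1 := by
  fin_cases μ <;> simp [sig]

lemma mdot_lo_left (μ : Fin 4) (a : Form1) : mdot (lo μ) a = sig μ * a μ := by
  simp [mdot, lo, Pi.single_apply]

lemma mdot_up_left (μ : Fin 4) (a : Form1) : mdot (up μ) a = a μ := by
  rw [up, ← mdotL_apply, map_smul, smul_apply, mdotL_apply, mdot_lo_left, smul_eq_mul, ← mul_assoc,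
    sig_mul_self, one_mul]

lemma lo_apply (μ ν : Fin 4) : lo μ ν = if ν = μ then 1 else 0 := Pi.single_apply ..

lemma eq_sum_lo (a : Form1) : a = ∑ μ, a μ • lo μ := pi_eq_sum_univ' a

lemma eq_sum_up (a : Form1) : a = ∑ μ, mdot a (lo μ) • up μ := by
  conv_lhs => rw [eq_sum_lo a]
  refine Finset.sum_congr rfl fun μ _ => ?_
  rw [up, smul_smul, mdot_comm, mdot_lo_left, mul_right_comm, sig_mul_self, one_mul]

lemma eq_of_forall_mdot_eq {a b : Form1} (h : ∀ n, mdot a n = mdot b n) : a = b := by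
  rw [eq_sum_up a, eq_sum_up b]
  simp only [h]

lemma mdot_adj (t : Form1 →L[ℝ] Form1) (a b : Form1) : mdot (adj t a) b = mdot a (t b) := by
  conv_rhs => rw [eq_sum_lo b]
  simp only [adj, ← mdotL_apply, map_sum, map_smul, sum_apply, smul_apply, smul_eq_mul]
  exact Finset.sum_congr rfl fun μ _ => by rw [mdotL_apply (up μ), mdot_up_left, mul_comm]

lemma mdot_hstar (h : Form1 → Form1 →L[ℝ] Form1) (x a b : Form1) :
    mdot (hstar h x a) b = mdot a ((h x).inverse b) := mdot_adj _ _ _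

end Minkowski

section ScalarProduct

open CliffordAlgebra

lemma minkQ_apply (a : Form1) : minkQ a = mdot a a := by
  simp only [minkQ, mdot, QuadraticMap.weightedSumSquares_apply, smul_eq_mul, mul_assoc]

lemma vec_mul_vec_add_swap (a b : Form1) :
    vec a * vec b + vec b * vec a = algebraMap ℝ STA (2 * mdot a b) := by
  have hpolar : QuadraticMap.polar minkQ a b = 2 * mdot a b := by
    simp only [QuadraticMap.polar, minkQ_apply, ← mdotL_apply, map_add, add_apply]
    rw [mdotL_apply b a, mdot_comm b a, ← mdotL_apply]
    ring
  rw [← hpolar]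
  exact ι_mul_ι_add_swap a b

lemma vec_lo_mul_vec_lo_of_ne {μ ν : Fin 4} (hne : ν ≠ μ) :
    vec (lo μ) * vec (lo ν) = -(vec (lo ν) * vec (lo μ)) := by
  refine eq_neg_of_add_eq_zero_left ?_
  rw [vec_mul_vec_add_swap, mdot_lo_left, lo_apply, if_neg hne.symm, mul_zero, mul_zero, map_zero]

lemma vec_up (μ : Fin 4) : vec (up μ) = sig μ • vec (lo μ) := map_smul ..

lemma vec_up_mul_vec_lo (μ : Fin 4) : vec (up μ) * vec (lo μ) = 1 := by
  rw [vec_up, smul_mul_assoc, ι_sq_scalar, minkQ_apply, mdot_lo_left, lo_apply, if_pos rfl,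
    mul_one, Algebra.smul_def, ← map_mul, sig_mul_self, map_one]

lemma commute_vec_lo_vec_up (μ : Fin 4) : Commute (vec (lo μ)) (vec (up μ)) := by
  rw [vec_up]
  exact (Commute.refl _).smul_right _

lemma isUnit_vec_lo (μ : Fin 4) : IsUnit (vec (lo μ)) :=
  isUnit_iff_exists.2 ⟨vec (up μ), (commute_vec_lo_vec_up μ).eq.trans (vec_up_mul_vec_lo μ),
    vec_up_mul_vec_lo μ⟩

lemma reverse_recBlade (I : Finset (Fin 4)) :
    reverse (recBlade I) = ((I.sort (· ≤ ·)).reverse.map fun μ => vec (up μ)).prod := by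
  have h := reverse_prod_map_ι (Q := minkQ) ((I.sort (· ≤ ·)).map up)
  rwa [List.map_map, ← List.map_reverse] at h

lemma reverse_recBlade_mul_blade (I : Finset (Fin 4)) : reverse (recBlade I) * blade I = 1 := by
  rw [reverse_recBlade]
  exact prod_map_reverse_mul_prod_map vec_up_mul_vec_lo _

lemma prod_map_vec_mem_evenOdd {ι : Type*} (f : ι → Form1) (L : List ι) :
    (L.map fun i => vec (f i)).prod ∈ evenOdd minkQ L.length := by
  have h := SetLike.list_prod_map_mem_graded (A := evenOdd minkQ) L (fun _ => 1)
    (fun i => vec (f i)) fun i _ => ι_mem_evenOdd_one minkQ (f i)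
  simpa using h

lemma blade_mem_evenOdd (I : Finset (Fin 4)) : blade I ∈ evenOdd minkQ I.card := by
  simpa [blade] using prod_map_vec_mem_evenOdd lo (I.sort (· ≤ ·))

lemma recBlade_mem_evenOdd (I : Finset (Fin 4)) : recBlade I ∈ evenOdd minkQ I.card := by
  simpa [recBlade] using prod_map_vec_mem_evenOdd up (I.sort (· ≤ ·))

instance instFiniteDimensionalSTA : FiniteDimensional ℝ STA :=
  .of_injective components.toLinearMap components.injective

lemma finrank_STA : Module.finrank ℝ STA = Fintype.card (Finset (Fin 4)) := by
  rw [components.finrank_eq, Module.finrank_fintype_fun_eq_card]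

/-- The scalar part `⟨X⟩₀` of a multiform, encoded as the normalized trace of left
multiplication by `X`. -/
def scalarPart : STA →ₗ[ℝ] ℝ :=
  (Module.finrank ℝ STA : ℝ)⁻¹ • (LinearMap.trace ℝ STA ∘ₗ LinearMap.mul ℝ STA)

lemma scalarPart_apply (X : STA) : scalarPart X
    = (Module.finrank ℝ STA : ℝ)⁻¹ * LinearMap.trace ℝ STA (LinearMap.mulLeft ℝ X) := rfl

lemma scalarPart_one : scalarPart 1 = 1 := by
  rw [scalarPart_apply, LinearMap.mulLeft_one, LinearMap.trace_id]
  exact inv_mul_cancel₀ (Nat.cast_ne_zero.2 Module.finrank_pos.ne')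

lemma scalarPart_eq_zero_of_mem_odd {X : STA} (hX : X ∈ evenOdd minkQ 1) : scalarPart X = 0 := by
  rw [scalarPart_apply, trace_mulLeft_eq_zero_of_mem_odd hX, mul_zero]

/-- The scalar product of multiforms, `(X, Y) ↦ ⟨X̃ Y⟩₀` with `X̃` the reverse of `X`. -/
def scalarProd : STA →L[ℝ] STA →L[ℝ] ℝ :=
  (((LinearMap.mul ℝ STA).compr₂ scalarPart) ∘ₗ reverse).toContinuousBilinearMap

lemma scalarProd_apply (X Y : STA) : scalarProd X Y = scalarPart (reverse X * Y) := rfl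

lemma add_eq_one_of_ne {m n : ZMod 2} (hmn : m ≠ n) : m + n = 1 := by
  revert m n
  decide

lemma mul_mem_evenOdd {m n k : ZMod 2} (hk : m + n = k) {X Y : STA} (hX : X ∈ evenOdd minkQ m)
    (hY : Y ∈ evenOdd minkQ n) : X * Y ∈ evenOdd minkQ k :=
  hk ▸ SetLike.mul_mem_graded hX hY

lemma scalarProd_eq_zero_of_ne {m n : ZMod 2} (hmn : m ≠ n) {X Y : STA}
    (hX : X ∈ evenOdd minkQ m) (hY : Y ∈ evenOdd minkQ n) : scalarProd X Y = 0 :=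
  scalarPart_eq_zero_of_mem_odd
    (mul_mem_evenOdd (add_eq_one_of_ne hmn) ((reverse_mem_evenOdd_iff minkQ).2 hX) hY)

lemma count_sort (I : Finset (Fin 4)) (μ : Fin 4) :
    (I.sort (· ≤ ·)).count μ = if μ ∈ I then 1 else 0 := by
  simp only [List.Nodup.count (I.sort_nodup _), Finset.mem_sort]

lemma vec_lo_mul_blade (μ : Fin 4) (I : Finset (Fin 4)) : vec (lo μ) * blade I
    = (-1) ^ (I.card + if μ ∈ I then 1 else 0) * (blade I * vec (lo μ)) := by
  rw [← count_sort, ← I.length_sort (· ≤ ·)]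
  exact mul_prod_map_of_anticommute (f := fun ν => vec (lo ν)) (.refl (vec (lo μ)))
    (fun ν hν => vec_lo_mul_vec_lo_of_ne hν) _

lemma vec_lo_mul_reverse_recBlade (μ : Fin 4) (I : Finset (Fin 4)) :
    vec (lo μ) * reverse (recBlade I)
      = (-1) ^ (I.card + if μ ∈ I then 1 else 0) * (reverse (recBlade I) * vec (lo μ)) := by
  rw [reverse_recBlade, ← count_sort, ← I.length_sort (· ≤ ·), ← List.length_reverse,
    ← List.count_reverse]
  refine mul_prod_map_of_anticommute (f := fun ν => vec (up ν)) (commute_vec_lo_vec_up μ)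
    (fun ν hν => ?_) _
  rw [vec_up, mul_smul_comm, vec_lo_mul_vec_lo_of_ne hν, smul_neg, smul_mul_assoc]

lemma scalarProd_recBlade_blade_of_ne {I J : Finset (Fin 4)} (hne : I ≠ J) :
    scalarProd (recBlade I) (blade J) = 0 := by
  by_cases hparity : (I.card : ZMod 2) = J.card
  swap
  · exact scalarProd_eq_zero_of_ne hparity (recBlade_mem_evenOdd I) (blade_mem_evenOdd J)
  obtain ⟨μ, hμ⟩ := Finset.symmDiff_nonempty.2 hne
  have hsign : Odd (I.card + (if μ ∈ I then 1 else 0) + (J.card + if μ ∈ J then 1 else 0)) := by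
    rw [← ZMod.natCast_eq_one_iff_odd]
    rcases Finset.mem_symmDiff.1 hμ with ⟨hI, hJ⟩ | ⟨hJ, hI⟩ <;>
      simp [hI, hJ, hparity, ← add_assoc, add_right_comm _ (1 : ZMod 2), CharTwo.add_self_eq_zero]
  have hanti : vec (lo μ) * (reverse (recBlade I) * blade J)
      = -(reverse (recBlade I) * blade J * vec (lo μ)) := by
    rw [← mul_assoc, vec_lo_mul_reverse_recBlade, mul_assoc, mul_assoc, vec_lo_mul_blade,
      ← mul_assoc (reverse _), ((Commute.neg_one_right (reverse (recBlade I))).pow_right _).eq,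
      mul_assoc, ← mul_assoc, ← pow_add, hsign.neg_one_pow, neg_one_mul, mul_assoc]
  rw [scalarProd_apply, scalarPart_apply,
    trace_mulLeft_eq_zero_of_anticommute (isUnit_vec_lo μ) hanti, mul_zero]

lemma scalarProd_recBlade_blade (I J : Finset (Fin 4)) :
    scalarProd (recBlade I) (blade J) = if I = J then 1 else 0 := by
  split_ifs with h
  · rw [h, scalarProd_apply, reverse_recBlade_mul_blade, scalarPart_one]
  · exact scalarProd_recBlade_blade_of_ne h

lemma eq_sum_recBlade (X : STA) : X = ∑ I, scalarProd X (blade I) • recBlade I :=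
  (sum_apply_smul_of_biorthogonal (ε := fun I => (scalarProd.flip (blade I)).toLinearMap)
    (fun I J => (scalarProd_recBlade_blade J I).trans (by simp only [eq_comm])) finrank_STA X).symm

lemma eq_sum_blade (X : STA) : X = ∑ I, scalarProd (recBlade I) X • blade I :=
  (sum_apply_smul_of_biorthogonal (ε := fun I => (scalarProd (recBlade I)).toLinearMap)
    scalarProd_recBlade_blade finrank_STA X).symm

lemma eq_zero_of_forall_scalarProd_eq_zero {n : ZMod 2} {X : STA} (hX : X ∈ evenOdd minkQ n)
    (h : ∀ Y ∈ evenOdd minkQ n, scalarProd X Y = 0) : X = 0 := by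
  rw [eq_sum_recBlade X]
  refine Finset.sum_eq_zero fun I _ => ?_
  by_cases hI : n = I.card
  · rw [h _ (hI ▸ blade_mem_evenOdd I), zero_smul]
  · rw [scalarProd_eq_zero_of_ne hI hX (blade_mem_evenOdd I), zero_smul]

lemma scalarProd_sum_filter_smul_recBlade (p : Finset (Fin 4) → Prop) [DecidablePred p]
    (φ : STA →L[ℝ] ℝ) {A : STA} (hA : ∀ I, ¬p I → scalarProd (recBlade I) A = 0) :
    scalarProd (∑ I with p I, φ (blade I) • recBlade I) A = φ A := by
  conv_rhs => rw [eq_sum_blade A]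
  simp only [map_sum, map_smul, sum_apply, smul_apply, smul_eq_mul, mul_comm (φ _)]
  refine Finset.sum_filter_of_ne fun I _ hI => ?_
  contrapose! hI
  rw [hA I hI, zero_mul]

lemma scalarProd_gradEven (f : STA → ℝ) (X : STA) {A : STA} (hA : A ∈ evenPart) :
    scalarProd (gradEven f X) A = fderiv ℝ f X A :=
  scalarProd_sum_filter_smul_recBlade _ _ fun I hI => scalarProd_eq_zero_of_ne
    (mt ZMod.natCast_eq_zero_iff_even.1 hI) (recBlade_mem_evenOdd I) hA

lemma scalarProd_gradOdd (f : STA → ℝ) (Y : STA) {A : STA} (hA : A ∈ evenOdd minkQ 1) :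
    scalarProd (gradOdd f Y) A = fderiv ℝ f Y A :=
  scalarProd_sum_filter_smul_recBlade _ _ fun I hI => scalarProd_eq_zero_of_ne
    (mt ZMod.natCast_eq_one_iff_odd.1 hI) (recBlade_mem_evenOdd I) hA

lemma gradEven_mem_evenPart (f : STA → ℝ) (X : STA) : gradEven f X ∈ evenPart := by
  refine Submodule.sum_mem _ fun I hI => Submodule.smul_mem _ _ ?_
  rw [evenPart, ← (Finset.mem_filter.1 hI).2.natCast_zmod_two]
  exact recBlade_mem_evenOdd I

lemma gradOdd_mem_evenOdd_one (f : STA → ℝ) (Y : STA) : gradOdd f Y ∈ evenOdd minkQ 1 := by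
  refine Submodule.sum_mem _ fun I hI => Submodule.smul_mem _ _ ?_
  rw [← (Finset.mem_filter.1 hI).2.natCast_zmod_two]
  exact recBlade_mem_evenOdd I

lemma scalarProd_vec_mul (a : Form1) (X Y : STA) :
    scalarProd X (vec a * Y) = scalarProd (vec a * X) Y := by
  rw [scalarProd_apply, scalarProd_apply, reverse.map_mul, reverse_ι, mul_assoc]

end ScalarProduct

section InverseAndDeterminant

variable {𝕜 E F G : Type*} [NontriviallyNormedField 𝕜] [NormedAddCommGroup E] [NormedSpace 𝕜 E]
  [NormedAddCommGroup F] [NormedSpace 𝕜 F] [NormedAddCommGroup G] [NormedSpace 𝕜 G]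

lemma differentiableAt_inverse [CompleteSpace E] {f : G → E →L[𝕜] F} {x : G}
    (hf : DifferentiableAt 𝕜 f x) (hi : (f x).IsInvertible) :
    DifferentiableAt 𝕜 (fun y => (f y).inverse) x :=
  (hi.contDiffAt_map_inverse.differentiableAt one_ne_zero).comp x hf

lemma fderiv_inverse_apply [CompleteSpace E] {f : G → E →L[𝕜] F} {x : G}
    (hf : DifferentiableAt 𝕜 f x) (hi : (f x).IsInvertible) (n : F) (a : G) :
    fderiv 𝕜 (fun y => (f y).inverse n) x a
      = -(f x).inverse (fderiv 𝕜 f x a ((f x).inverse n)) := by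
  have hinv : DifferentiableAt 𝕜 (fun y => (f y).inverse n) x :=
    (differentiableAt_inverse hf hi).clm_apply (differentiableAt_const n)
  have heventually : ∀ᶠ y in nhds x, (f y).IsInvertible := by
    obtain ⟨e, he⟩ := hi
    exact hf.continuousAt.eventually (he ▸ e.nhds)
  have hconst : (fun y => f y ((f y).inverse n)) =ᶠ[nhds x] fun _ => n :=
    heventually.mono fun y hy => hy.self_apply_inverse n
  have hproduct := (hf.hasFDerivAt.clm_apply hinv.hasFDerivAt).fderiv
  rw [hconst.fderiv_eq, fderiv_fun_const] at hproduct
  have happly := congrArg (fun T => (f x).inverse (T a)) hproduct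
  simp only [Pi.zero_apply, zero_apply, map_zero, add_apply, ContinuousLinearMap.comp_apply,
    ContinuousLinearMap.flip_apply, map_add, hi.inverse_apply_self] at happly
  exact eq_neg_of_add_eq_zero_left happly.symm

lemma contDiffOn_inverse [CompleteSpace E] {f : G → E →L[𝕜] F} {U : Set G} {n : WithTop ℕ∞}
    (hf : ContDiffOn 𝕜 n f U) (hi : ∀ x ∈ U, (f x).IsInvertible) :
    ContDiffOn 𝕜 n (fun x => (f x).inverse) U := fun x hx =>
  (hi x hx).contDiffAt_map_inverse.comp_contDiffWithinAt x (hf x hx)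

lemma det_ne_zero_of_isInvertible {T : E →L[𝕜] E} (hT : T.IsInvertible) : T.det ≠ 0 := by
  obtain ⟨e, rfl⟩ := hT
  exact e.toLinearEquiv.isUnit_det'.ne_zero

variable [FiniteDimensional 𝕜 E]

lemma hasDerivAt_det_one_add_smul (S : E →L[𝕜] E) :
    HasDerivAt (fun t : 𝕜 => (1 + t • S).det) (LinearMap.trace 𝕜 E S) 0 := by
  let b := Module.finBasis 𝕜 E
  set A := LinearMap.toMatrix b b S
  let r := (1 + (Polynomial.X : Polynomial 𝕜) • A.map Polynomial.C).det.divX.divX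
  have hdet (t : 𝕜) : (1 + t • S).det = 1 + A.trace * t + r.eval t * t ^ 2 := by
    have hmatrix : (1 + t • A).det = (1 + t • S).det := by
      rw [ContinuousLinearMap.det, ← LinearMap.det_toMatrix b, ContinuousLinearMap.toLinearMap_add,
        map_add, ContinuousLinearMap.toLinearMap_smul, map_smul,
        ContinuousLinearMap.toLinearMap_one, LinearMap.toMatrix_one]
    rw [← hmatrix, Matrix.det_one_add_smul]
  rw [funext hdet, LinearMap.trace_eq_matrix_trace 𝕜 b]
  have := (((hasDerivAt_id (0 : 𝕜)).const_mul A.trace).const_add 1).add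
    ((r.hasDerivAt 0).mul ((hasDerivAt_id (0 : 𝕜)).pow 2))
  exact this.congr_deriv (by simp [A])

variable [CompleteSpace 𝕜]

lemma contDiff_det {n : WithTop ℕ∞} : ContDiff 𝕜 n fun T : E →L[𝕜] E => T.det := by
  have hdet (T : E →L[𝕜] E) :
      T.det = (LinearMap.toMatrix (Module.finBasis 𝕜 E) (Module.finBasis 𝕜 E) T).det :=
    (LinearMap.det_toMatrix _ _).symm
  simp only [hdet, Matrix.det_apply, LinearMap.toMatrix_apply]
  refine ContDiff.sum fun σ _ => .const_smul _ (contDiff_prod fun i _ => ?_)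
  exact (LinearMap.toContinuousLinearMap ((Module.finBasis 𝕜 E).coord (σ i))).contDiff.comp
    (contDiff_id.clm_apply contDiff_const)

lemma fderiv_det_apply {T : E →L[𝕜] E} (hT : T.IsInvertible) (B : E →L[𝕜] E) :
    fderiv 𝕜 ContinuousLinearMap.det T B = T.det * LinearMap.trace 𝕜 E (T.inverse ∘L B) := by
  have hdet : HasFDerivAt ContinuousLinearMap.det (fderiv 𝕜 ContinuousLinearMap.det T)
      (T + (0 : 𝕜) • B) := by
    simpa using (contDiff_det.differentiable one_ne_zero T).hasFDerivAt
  have hline : HasDerivAt (fun t : 𝕜 => T + t • B) B 0 := by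
    simpa using ((hasDerivAt_id (0 : 𝕜)).smul_const B).const_add T
  have hfactor (t : 𝕜) : (T + t • B).det = T.det * (1 + t • (T.inverse ∘L B)).det := by
    have : T + t • B = T ∘L (1 + t • (T.inverse ∘L B)) := by
      ext v
      simp [hT.self_apply_inverse]
    rw [this]
    exact LinearMap.det_comp _ _
  have hderiv := (hasDerivAt_det_one_add_smul (T.inverse ∘L B)).const_mul T.det
  simp only [← hfactor] at hderiv
  exact HasDerivAt.unique (hdet.comp_hasDerivAt (f := fun t : 𝕜 => T + t • B) 0 hline) hderiv

lemma differentiableAt_det {f : G → E →L[𝕜] E} {x : G} (hf : DifferentiableAt 𝕜 f x) :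
    DifferentiableAt 𝕜 (fun y => (f y).det) x :=
  (contDiff_det.differentiable one_ne_zero (f x)).comp x hf

lemma fderiv_det_comp_apply {f : G → E →L[𝕜] E} {x : G} (hf : DifferentiableAt 𝕜 f x)
    (hi : (f x).IsInvertible) (a : G) : fderiv 𝕜 (fun y => (f y).det) x a
      = (f x).det * LinearMap.trace 𝕜 E ((f x).inverse ∘L fderiv 𝕜 f x a) := by
  rw [← fderiv_det_apply hi]
  exact congrArg (· a) (fderiv_comp x (contDiff_det.differentiable one_ne_zero _) hf)

end InverseAndDeterminant

section SkewMaps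

variable {W : Form1 → Form1}

lemma isLinearMap_of_skew (hW : ∀ m n, mdot (W m) n = -mdot m (W n)) : IsLinearMap ℝ W := by
  constructor <;> intros <;> refine eq_of_forall_mdot_eq fun n => ?_
  · rw [hW, ← mdotL_apply, ← mdotL_apply, map_add, map_add, add_apply, add_apply]
    simp only [mdotL_apply, hW, neg_add]
  · rw [hW, ← mdotL_apply, ← mdotL_apply, map_smul, map_smul, smul_apply, smul_apply]
    simp only [mdotL_apply, hW, smul_neg]

lemma trace_eq_sum (f : Form1 →ₗ[ℝ] Form1) : LinearMap.trace ℝ Form1 f = ∑ μ, f (lo μ) μ := by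
  simp [LinearMap.trace_eq_matrix_trace ℝ (Pi.basisFun ℝ (Fin 4)), Matrix.trace, lo]

lemma trace_eq_zero_of_skew {f : Form1 →ₗ[ℝ] Form1} (hf : ∀ m n, mdot (f m) n = -mdot m (f n)) :
    LinearMap.trace ℝ Form1 f = 0 := by
  rw [trace_eq_sum]
  refine Finset.sum_eq_zero fun μ _ => ?_
  have h := hf (lo μ) (up μ)
  rw [mdot_comm, mdot_up_left, up, map_smul, ← mdotL_apply, map_smul, mdotL_apply, mdot_lo_left,
    smul_eq_mul, ← mul_assoc, sig_mul_self, one_mul] at h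
  linarith

lemma sum_conj_apply_eq_zero_of_skew (hW : ∀ m n, mdot (W m) n = -mdot m (W n))
    {T : Form1 →L[ℝ] Form1} (hT : T.IsInvertible) : ∑ μ, T.inverse (W (T (lo μ))) μ = 0 := by
  obtain ⟨e, rfl⟩ := hT
  let f := (isLinearMap_of_skew hW).mk' W
  have h : LinearMap.trace ℝ Form1 (e.symm.toLinearEquiv.conj f) = 0 :=
    (LinearMap.trace_conj' f _).trans (trace_eq_zero_of_skew hW)
  rw [trace_eq_sum] at h
  simpa [LinearEquiv.conj_apply, f] using h

lemma commutator_wedge (a b c : Form1) :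
    wedge a b * vec c - vec c * wedge a b = (2 : ℝ) • vec (mdot b c • a - mdot a c • b) := by
  have hprod (a b : Form1) : vec a * vec b * vec c - vec c * (vec a * vec b)
      = (2 : ℝ) • vec (mdot b c • a - mdot a c • b) := by
    have hsplit : vec a * vec b * vec c - vec c * (vec a * vec b)
        = vec a * (vec b * vec c + vec c * vec b) - (vec a * vec c + vec c * vec a) * vec b := by
      noncomm_ring
    rw [hsplit, vec_mul_vec_add_swap a c, vec_mul_vec_add_swap b c, ← Algebra.commutes,
      ← Algebra.smul_def, ← Algebra.smul_def]
    simp only [vec, map_sub, map_smul, smul_sub, smul_smul]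
  have hsplit : wedge a b * vec c - vec c * wedge a b
      = (1 / 2 : ℝ) • ((vec a * vec b * vec c - vec c * (vec a * vec b))
        - (vec b * vec a * vec c - vec c * (vec b * vec a))) := by
    rw [wedge, smul_mul_assoc, mul_smul_comm, ← smul_sub]
    congr 1
    noncomm_ring
  rw [hsplit, hprod, hprod]
  simp only [vec, map_sub, map_smul]
  module

lemma commutator_sum_wedge_of_skew (hW : ∀ m n, mdot (W m) n = -mdot m (W n)) (n : Form1) :
    (∑ μ, wedge (up μ) (W (lo μ))) * vec n - vec n * ∑ μ, wedge (up μ) (W (lo μ))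
      = -(4 : ℝ) • vec (W n) := by
  have hup : ∑ μ, mdot (W (lo μ)) n • up μ = -W n := by
    rw [eq_sum_up (W n), ← Finset.sum_neg_distrib]
    exact Finset.sum_congr rfl fun μ _ => by rw [hW, mdot_comm, neg_smul]
  have hlo : ∑ μ, n μ • W (lo μ) = W n := by
    have hsum := map_sum ((isLinearMap_of_skew hW).mk' W) (fun μ => n μ • lo μ) Finset.univ
    rw [← eq_sum_lo] at hsum
    simpa only [IsLinearMap.mk'_apply, (isLinearMap_of_skew hW).map_smul] using hsum.symm
  calc (∑ μ, wedge (up μ) (W (lo μ))) * vec n - vec n * ∑ μ, wedge (up μ) (W (lo μ))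
      = ∑ μ, (2 : ℝ) • vec (mdot (W (lo μ)) n • up μ - n μ • W (lo μ)) := by
        simp only [Finset.sum_mul, Finset.mul_sum, ← Finset.sum_sub_distrib, commutator_wedge,
          mdot_up_left]
    _ = (2 : ℝ) • vec (-W n - W n) := by
        rw [← Finset.smul_sum, vec, ← map_sum, Finset.sum_sub_distrib, hup, hlo]
    _ = -(4 : ℝ) • vec (W n) := by
        rw [vec, map_sub, map_neg]
        module

end SkewMaps

section Connection

variable {h : Form1 → Form1 →L[ℝ] Form1} {x : Form1}

lemma fderiv_metric (hd : DifferentiableAt ℝ h x) (a b c : Form1) :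
    fderiv ℝ (fun y => metric h y b c) x a
      = mdot (fderiv ℝ h x a b) (h x c) + mdot (h x b) (fderiv ℝ h x a c) := by
  have happly (b : Form1) : HasFDerivAt (fun y => h y b) ((fderiv ℝ h x).flip b) x := by
    simpa using hd.hasFDerivAt.clm_apply (hasFDerivAt_const b x)
  have hbilin := (mdotL.hasFDerivAt_of_bilinear (happly b) (happly c)).fderiv
  change fderiv ℝ (fun y => mdotL (h y b) (h y c)) x a = _
  rw [hbilin]
  simp [mdotL_apply, add_comm]

lemma christoffelLower_add_swap (a b c : Form1) :
    christoffelLower h x a b c + christoffelLower h x a c b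
      = fderiv ℝ (fun y => metric h y b c) x a := by
  have hsymm (a b : Form1) : (fun y => metric h y a b) = fun y => metric h y b a :=
    funext fun y => mdot_comm _ _
  rw [christoffelLower, christoffelLower, hsymm c b, hsymm a c, hsymm a b]
  ring

lemma christoffelLower_comm (a b c : Form1) :
    christoffelLower h x a b c = christoffelLower h x b a c := by
  have hsymm : (fun y => metric h y a b) = fun y => metric h y b a :=
    funext fun y => mdot_comm _ _
  rw [christoffelLower, christoffelLower, hsymm]
  ring

lemma christoffel_comm (a b : Form1) : christoffel h x a b = christoffel h x b a := by
  simp only [christoffel, christoffelLower_comm a b]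

lemma christoffelLower_eq_sum (hd : DifferentiableAt ℝ h x) (a b c : Form1) :
    christoffelLower h x a b c = ∑ μ, c μ * christoffelLower h x a b (lo μ) := by
  have hlin : IsLinearMap ℝ (christoffelLower h x a b) := by
    constructor <;> intros <;>
      simp only [christoffelLower, fderiv_metric hd, ← mdotL_apply, map_add, map_smul, add_apply,
        smul_apply, smul_eq_mul] <;> ring
  have hsum := map_sum (hlin.mk' _) (fun μ => c μ • lo μ) Finset.univ
  rw [← eq_sum_lo] at hsum
  simpa only [IsLinearMap.mk'_apply, hlin.map_smul, smul_eq_mul] using hsum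

lemma mdot_christoffel (hd : DifferentiableAt ℝ h x) (hi : (h x).IsInvertible) (a b c : Form1) :
    mdot (h x (christoffel h x a b)) (h x c) = christoffelLower h x a b c := by
  rw [christoffel, christoffelLower_eq_sum hd, ← mdotL_apply, map_sum, map_sum, sum_apply]
  refine Finset.sum_congr rfl fun μ _ => ?_
  rw [map_smul, map_smul, smul_apply, mdotL_apply, hi.self_apply_inverse, mdot_hstar,
    hi.inverse_apply_self, mdot_up_left, smul_eq_mul, mul_comm]

lemma gaugeDeriv_const (hd : DifferentiableAt ℝ h x) (hi : (h x).IsInvertible) (a n : Form1) :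
    gaugeDeriv h a (fun _ => n) x
      = h x (christoffel h x a ((h x).inverse n)) - fderiv ℝ h x a ((h x).inverse n) := by
  rw [gaugeDeriv, leviCivita, fderiv_inverse_apply hd hi, map_add, map_neg, hi.self_apply_inverse,
    neg_add_eq_sub]

lemma mdot_gaugeDeriv_const (hd : DifferentiableAt ℝ h x) (hi : (h x).IsInvertible)
    (a m n : Form1) : mdot (gaugeDeriv h a (fun _ => m) x) n
      = -mdot m (gaugeDeriv h a (fun _ => n) x) := by
  obtain ⟨b, rfl⟩ : ∃ b, m = h x b := ⟨_, (hi.self_apply_inverse m).symm⟩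
  obtain ⟨c, rfl⟩ : ∃ c, n = h x c := ⟨_, (hi.self_apply_inverse n).symm⟩
  have hmetric := (christoffelLower_add_swap a b c).trans (fderiv_metric hd a b c)
  rw [← mdot_christoffel hd hi, ← mdot_christoffel hd hi, mdot_comm _ (h x b)] at hmetric
  rw [gaugeDeriv_const hd hi, gaugeDeriv_const hd hi, hi.inverse_apply_self, hi.inverse_apply_self,
    ← mdotL_apply, ← mdotL_apply, map_sub, map_sub, sub_apply]
  simp only [mdotL_apply]
  linarith

lemma commutator_Omega (hd : DifferentiableAt ℝ h x) (hi : (h x).IsInvertible) (a n : Form1) :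
    (1 / 2 : ℝ) • (Omega h x a * vec n - vec n * Omega h x a)
      = vec (gaugeDeriv h a (fun _ => n) x) := by
  rw [Omega, smul_mul_assoc, mul_smul_comm, ← smul_sub,
    commutator_sum_wedge_of_skew (mdot_gaugeDeriv_const hd hi a)]
  module

lemma det_mul_sum_christoffel (hd : DifferentiableAt ℝ h x) (hi : (h x).IsInvertible)
    (b : Form1) :
    (h x).det * ∑ μ, christoffel h x (lo μ) b μ = fderiv ℝ (fun y => (h y).det) x b := by
  have htrace := sum_conj_apply_eq_zero_of_skew (mdot_gaugeDeriv_const hd hi b) hi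
  simp only [gaugeDeriv_const hd hi, hi.inverse_apply_self, map_sub, Pi.sub_apply,
    Finset.sum_sub_distrib, christoffel_comm b] at htrace
  rw [fderiv_det_comp_apply hd hi, trace_eq_sum, sub_eq_zero.1 htrace]
  rfl

lemma det_mul_sum_leviCivita (hd : DifferentiableAt ℝ h x) (hi : (h x).IsInvertible)
    {v : Form1 → Form1} (hv : DifferentiableAt ℝ v x) :
    (h x).det * ∑ μ, leviCivita h (lo μ) v x μ
      = ∑ μ, fderiv ℝ (fun y => (h y).det * v y μ) x (lo μ) := by
  have hproduct (μ : Fin 4) : fderiv ℝ (fun y => (h y).det * v y μ) x (lo μ)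
      = (h x).det * fderiv ℝ v x (lo μ) μ + v x μ * fderiv ℝ (fun y => (h y).det) x (lo μ) := by
    rw [fderiv_fun_mul (differentiableAt_det hd) (differentiableAt_pi.1 hv μ), fderiv_apply hv]
    rfl
  have hdirection : ∑ μ, v x μ * fderiv ℝ (fun y => (h y).det) x (lo μ)
      = fderiv ℝ (fun y => (h y).det) x (v x) := by
    conv_rhs => rw [eq_sum_lo (v x)]
    simp only [map_sum, map_smul, smul_eq_mul]
  simp only [leviCivita, Pi.add_apply, hproduct, Finset.sum_add_distrib, mul_add, hdirection,
    det_mul_sum_christoffel hd hi, Finset.mul_sum]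

lemma differentiableAt_det_smul_hstar (hd : DifferentiableAt ℝ h x) (hi : (h x).IsInvertible)
    (a : Form1) : DifferentiableAt ℝ (fun y => (h y).det • hstar h y a) x := by
  have hdet := differentiableAt_det hd
  have hinv := differentiableAt_inverse hd hi
  simp only [hstar, adj, ← mdotL_apply]
  fun_prop

lemma sum_fderiv_det_smul_hstar (hd : DifferentiableAt ℝ h x) (hi : (h x).IsInvertible) :
    ∑ μ, fderiv ℝ (fun y => (h y).det • hstar h y (up μ)) x (lo μ)
      = -(h x).det • ∑ μ, gaugeDeriv h (lo μ) (fun _ => hstar h x (up μ)) x := by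
  refine eq_of_forall_mdot_eq fun n => ?_
  have hv : DifferentiableAt ℝ (fun y => (h y).inverse n) x :=
    (differentiableAt_inverse hd hi).clm_apply (differentiableAt_const n)
  have hpair (μ : Fin 4) : mdot (fderiv ℝ (fun y => (h y).det • hstar h y (up μ)) x (lo μ)) n
      = fderiv ℝ (fun y => (h y).det * (h y).inverse n μ) x (lo μ) := by
    have hchain := (mdotL.flip n).hasFDerivAt.comp x
      (differentiableAt_det_smul_hstar hd hi (up μ)).hasFDerivAt
    rw [← mdotL_apply]
    refine (congrArg (· (lo μ)) hchain.fderiv).symm.trans ?_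
    congr 2 with y
    simp [mdotL_apply, mdot_hstar, mdot_up_left]
  have hgauge (μ : Fin 4) : leviCivita h (lo μ) (fun y => (h y).inverse n) x μ
      = -mdot (gaugeDeriv h (lo μ) (fun _ => hstar h x (up μ)) x) n := by
    rw [mdot_gaugeDeriv_const hd hi, neg_neg, mdot_hstar, mdot_up_left, gaugeDeriv,
      hi.inverse_apply_self]
  rw [← mdotL_apply, ← mdotL_apply, map_sum, sum_apply, map_smul, map_sum, smul_apply, sum_apply,
    neg_smul, smul_eq_mul]
  simp only [mdotL_apply, hpair]
  rw [← det_mul_sum_leviCivita hd hi hv]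
  simp only [hgauge, Finset.sum_neg_distrib, mul_neg]

end Connection

section IntegrationByParts

open CliffordAlgebra

/-- The inclusion `vec` of 1-forms as a continuous linear map. -/
def vecL : Form1 →L[ℝ] STA := (ι minkQ).toContinuousLinearMap

lemma vecL_apply (a : Form1) : vecL a = vec a := rfl

/-- The Clifford product as a continuous bilinear map. -/
def mulL : STA →L[ℝ] STA →L[ℝ] STA := (LinearMap.mul ℝ STA).toContinuousBilinearMap

lemma mulL_apply (X Y : STA) : mulL X Y = X * Y := rfl

lemma reverse_wedge (a b : Form1) : reverse (wedge a b) = -wedge a b := by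
  simp only [wedge, map_smul, map_sub, reverse.map_mul, reverse_ι]
  rw [← smul_neg, neg_sub]

lemma reverse_Omega (h : Form1 → Form1 →L[ℝ] Form1) (x a : Form1) :
    reverse (Omega h x a) = -Omega h x a := by
  simp only [Omega, map_smul, map_sum, reverse_wedge, Finset.sum_neg_distrib, smul_neg]

lemma scalarProd_Omega_mul (h : Form1 → Form1 →L[ℝ] Form1) (x a : Form1) (X Y : STA) :
    scalarProd (Omega h x a * X) Y = -scalarProd X (Omega h x a * Y) := by
  rw [scalarProd_apply, scalarProd_apply, reverse.map_mul, reverse_Omega, mul_neg, neg_mul,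
    map_neg, mul_assoc]

lemma fderiv_scalarProd_vec_mul {x : Form1} {v : Form1 → Form1} {P η : Form1 → STA}
    (hv : DifferentiableAt ℝ v x) (hP : DifferentiableAt ℝ P x) (hη : DifferentiableAt ℝ η x)
    (a : Form1) :
    fderiv ℝ (fun y => scalarProd (vec (v y) * P y) (η y)) x a
      = scalarProd (vec (fderiv ℝ v x a) * P x) (η x)
        + scalarProd (vec (v x) * fderiv ℝ P x a) (η x)
        + scalarProd (vec (v x) * P x) (fderiv ℝ η x a) := by
  have hvec : HasFDerivAt (fun y => vecL (v y)) (vecL ∘L fderiv ℝ v x) x :=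
    vecL.hasFDerivAt.comp x hv.hasFDerivAt
  have hprod := scalarProd.hasFDerivAt_of_bilinear
    (mulL.hasFDerivAt_of_bilinear hvec hP.hasFDerivAt) hη.hasFDerivAt
  simp only [mulL_apply, vecL_apply] at hprod
  rw [hprod.fderiv]
  simp only [ContinuousLinearMap.precompR_apply, ContinuousLinearMap.compL_apply, map_add,
    add_apply, ContinuousLinearMap.comp_apply, ContinuousLinearMap.precompL_apply, mulL_apply,
    vecL_apply]
  ring

/-- The components `det(h) ⟨h^*(γ^μ) P, η⟩` of the vector field on spacetime whose divergence is
the boundary term in the integration by parts of the spinor derivative. -/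
def flux (h : Form1 → Form1 →L[ℝ] Form1) (P η : Form1 → STA) (μ : Fin 4) (x : Form1) : ℝ :=
  scalarProd (vec ((h x).det • hstar h x (up μ)) * P x) (η x)

variable {h : Form1 → Form1 →L[ℝ] Form1} {x : Form1}

lemma scalarProd_spinorDeriv (P : Form1 → STA) (Y : STA) :
    scalarProd (spinorDeriv h P x) Y
      = ∑ μ, (scalarProd (vec (hstar h x (up μ)) * fderiv ℝ P x (lo μ)) Y
        + (1 / 2 : ℝ) * scalarProd (vec (hstar h x (up μ)) * (Omega h x (lo μ) * P x)) Y) := by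
  simp only [spinorDeriv, spinorDirDeriv, mul_add, mul_smul_comm, map_sum, map_add, map_smul,
    sum_apply, add_apply, smul_apply, smul_eq_mul]

lemma scalarProd_spinorDeriv_right (X : STA) (η : Form1 → STA) :
    scalarProd X (spinorDeriv h η x)
      = ∑ μ, (scalarProd (vec (hstar h x (up μ)) * X) (fderiv ℝ η x (lo μ))
        + (1 / 2 : ℝ) * scalarProd (vec (hstar h x (up μ)) * X) (Omega h x (lo μ) * η x)) := by
  simp only [spinorDeriv, spinorDirDeriv, map_sum, scalarProd_vec_mul, map_add, map_smul,
    smul_eq_mul]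

lemma sum_scalarProd_vec_fderiv_det_smul_hstar (hd : DifferentiableAt ℝ h x)
    (hi : (h x).IsInvertible) (X Y : STA) :
    ∑ μ, scalarProd (vec (fderiv ℝ (fun y => (h y).det • hstar h y (up μ)) x (lo μ)) * X) Y
      = (h x).det * ∑ μ, (1 / 2 : ℝ)
        * (scalarProd (vec (hstar h x (up μ)) * (Omega h x (lo μ) * X)) Y
          + scalarProd (vec (hstar h x (up μ)) * X) (Omega h x (lo μ) * Y)) := by
  calc ∑ μ, scalarProd (vec (fderiv ℝ (fun y => (h y).det • hstar h y (up μ)) x (lo μ)) * X) Y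
      = scalarProd (vec (∑ μ, fderiv ℝ (fun y => (h y).det • hstar h y (up μ)) x (lo μ)) * X)
          Y := by
        simp only [vec, map_sum, Finset.sum_mul, sum_apply]
    _ = -(h x).det * ∑ μ, scalarProd (vec (gaugeDeriv h (lo μ)
          (fun _ => hstar h x (up μ)) x) * X) Y := by
        rw [sum_fderiv_det_smul_hstar hd hi]
        simp only [vec, map_smul, map_sum, smul_mul_assoc, Finset.sum_mul, smul_apply, sum_apply,
          smul_eq_mul]
    _ = _ := by
        simp only [← commutator_Omega hd hi, smul_mul_assoc, sub_mul, mul_assoc, map_smul, map_sub,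
          smul_apply, sub_apply, scalarProd_Omega_mul h x _ (vec _ * X), smul_eq_mul]
        rw [neg_mul, ← mul_neg, ← Finset.sum_neg_distrib]
        congr! 2
        ring

lemma sum_fderiv_flux (hd : DifferentiableAt ℝ h x) (hi : (h x).IsInvertible)
    {P η : Form1 → STA} (hP : DifferentiableAt ℝ P x) (hη : DifferentiableAt ℝ η x) :
    ∑ μ, fderiv ℝ (flux h P η μ) x (lo μ)
      = (h x).det * (scalarProd (spinorDeriv h P x) (η x)
        + scalarProd (P x) (spinorDeriv h η x)) := by
  have hflux (μ : Fin 4) : fderiv ℝ (flux h P η μ) x (lo μ) = _ :=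
    fderiv_scalarProd_vec_mul (differentiableAt_det_smul_hstar hd hi (up μ)) hP hη (lo μ)
  simp only [hflux, Finset.sum_add_distrib, scalarProd_spinorDeriv, scalarProd_spinorDeriv_right,
    sum_scalarProd_vec_fderiv_det_smul_hstar hd hi]
  simp only [vec, map_smul, smul_mul_assoc, smul_apply, smul_eq_mul, mul_add,
    Finset.sum_add_distrib, Finset.mul_sum]
  ring

end IntegrationByParts

section PartialDerivatives

variable {𝕜 E F G H : Type*} [NontriviallyNormedField 𝕜] [NormedAddCommGroup E] [NormedSpace 𝕜 E]
  [NormedAddCommGroup F] [NormedSpace 𝕜 F] [NormedAddCommGroup G] [NormedSpace 𝕜 G]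
  [NormedAddCommGroup H] [NormedSpace 𝕜 H] {l : E × F × G → H} {x : E} {X : F} {Y : G}

lemma fderiv_snd_fst_apply (hl : DifferentiableAt 𝕜 l (x, X, Y)) (A : F) :
    fderiv 𝕜 (fun Z => l (x, Z, Y)) X A = fderiv 𝕜 l (x, X, Y) (0, A, 0) := by
  have hpath := (hasFDerivAt_const (𝕜 := 𝕜) x X).prodMk (hasFDerivAt_prodMk_left X Y)
  exact congrArg (· A) (hl.hasFDerivAt.comp X hpath).fderiv

lemma fderiv_snd_snd_apply (hl : DifferentiableAt 𝕜 l (x, X, Y)) (B : G) :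
    fderiv 𝕜 (fun Z => l (x, X, Z)) Y B = fderiv 𝕜 l (x, X, Y) (0, 0, B) := by
  have hpath := (hasFDerivAt_const (𝕜 := 𝕜) x Y).prodMk (hasFDerivAt_prodMk_right X Y)
  exact congrArg (· B) (hl.hasFDerivAt.comp Y hpath).fderiv

lemma hasDerivAt_comp_add_smul (hl : DifferentiableAt 𝕜 l (x, X, Y)) (A : F) (B : G) :
    HasDerivAt (fun t : 𝕜 => l (x, X + t • A, Y + t • B))
      (fderiv 𝕜 (fun Z => l (x, Z, Y)) X A + fderiv 𝕜 (fun Z => l (x, X, Z)) Y B) 0 := by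
  have hline : HasDerivAt (fun t : 𝕜 => (x, X + t • A, Y + t • B)) ((0 : E), A, B) 0 := by
    have hX := ((hasDerivAt_id (0 : 𝕜)).smul_const A).const_add X
    have hY := ((hasDerivAt_id (0 : 𝕜)).smul_const B).const_add Y
    simpa using (hasDerivAt_const (0 : 𝕜) x).prodMk (hX.prodMk hY)
  have hl₀ : HasFDerivAt l (fderiv 𝕜 l (x, X, Y)) (x, X + (0 : 𝕜) • A, Y + (0 : 𝕜) • B) := by
    simpa using hl.hasFDerivAt
  rw [fderiv_snd_fst_apply hl, fderiv_snd_snd_apply hl, ← map_add, Prod.mk_add_mk, Prod.mk_add_mk,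
    add_zero, add_zero, zero_add]
  exact hl₀.comp_hasDerivAt 0 hline

end PartialDerivatives

section FieldsOnOpenSets

variable {𝕜 E F : Type*} [NontriviallyNormedField 𝕜] [NormedAddCommGroup E] [NormedSpace 𝕜 E]
  [NormedAddCommGroup F] [NormedSpace 𝕜 F]

lemma fderiv_apply_mem {f : E → F} {p : Submodule 𝕜 F} (hp : IsClosed (p : Set F))
    (hf : ∀ x, f x ∈ p) (x a : E) : fderiv 𝕜 f x a ∈ p := by
  by_cases hd : DifferentiableAt 𝕜 f x
  · rw [← hd.lineDeriv_eq_fderiv]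
    have hspan := range_deriv_subset_closure_span_image (fun t : 𝕜 => f (x + t • a)) dense_univ
      (Set.mem_range_self 0)
    refine closure_minimal (Submodule.span_le.2 ?_) hp hspan
    rintro _ ⟨t, -, rfl⟩
    exact hf _
  · rw [fderiv_zero_of_not_differentiableAt hd]
    exact p.zero_mem

lemma contDiffOn_fderiv_comp {G : Type*} [NormedAddCommGroup G] [NormedSpace 𝕜 G] {l : F → G}
    {p : E → F} {U : Set E} {m n : WithTop ℕ∞} (hmn : m + 1 ≤ n)
    (hl : ∀ x ∈ U, ContDiffAt 𝕜 n l (p x)) (hp : ContDiffOn 𝕜 m p U) :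
    ContDiffOn 𝕜 m (fun x => fderiv 𝕜 l (p x)) U := fun x hx =>
  ((hl x hx).fderiv_right hmn).comp_contDiffWithinAt x (hp x hx)

lemma contDiff_of_tsupport_subset {f : E → F} {U : Set E} {n : WithTop ℕ∞} (hU : IsOpen U)
    (hf : ContDiffOn 𝕜 n f U) (hs : tsupport f ⊆ U) : ContDiff 𝕜 n f := by
  refine contDiff_iff_contDiffAt.2 fun x => ?_
  by_cases hx : x ∈ tsupport f
  · exact hf.contDiffAt (hU.mem_nhds (hs hx))
  · exact contDiffAt_const.congr_of_eventuallyEq (notMem_tsupport_iff_eventuallyEq.1 hx)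

end FieldsOnOpenSets

section VariationalCalculus

variable {E F : Type*} [NormedAddCommGroup E] [NormedSpace ℝ E] [MeasurableSpace E] [BorelSpace E]
  [NormedAddCommGroup F] [NormedSpace ℝ F] {μ : Measure E}

lemma integrable_fderiv_apply [IsFiniteMeasureOnCompacts μ] {f : E → F} (hf : ContDiff ℝ 1 f)
    (hc : HasCompactSupport f) (v : E) : Integrable (fun x => fderiv ℝ f x v) μ :=
  ((hf.continuous_fderiv one_ne_zero).clm_apply continuous_const).integrable_of_hasCompactSupport
    (hc.fderiv_apply ℝ v)

variable [FiniteDimensional ℝ E] [μ.IsAddHaarMeasure]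

lemma integral_fderiv_apply_eq_zero {f : E → F} (hf : ContDiff ℝ 1 f) (hc : HasCompactSupport f)
    (v : E) : ∫ x, fderiv ℝ f x v ∂μ = 0 := by
  have hparts := integral_smul_fderiv_eq_neg_fderiv_smul_of_integrable (μ := μ) (v := v)
    (f := fun _ => (1 : ℝ)) (g := f) (by simp)
    (by simpa using integrable_fderiv_apply hf hc v)
    (by simpa using hf.continuous.integrable_of_hasCompactSupport hc)
    (fun _ _ => differentiableAt_const _) fun x _ => hf.differentiable one_ne_zero x
  simpa using hparts

lemma setIntegral_add_sum_fderiv_apply {ι : Type*} [Fintype ι] {g : E → F} {f : ι → E → F}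
    {U : Set E} (hg : IntegrableOn g U μ) (hU : IsOpen U) (hf : ∀ i, ContDiffOn ℝ 1 (f i) U)
    (hc : ∀ i, HasCompactSupport (f i)) (hs : ∀ i, tsupport (f i) ⊆ U) (v : ι → E) :
    ∫ x in U, (g x + ∑ i, fderiv ℝ (f i) x (v i)) ∂μ = ∫ x in U, g x ∂μ := by
  have hf' (i : ι) : ContDiff ℝ 1 (f i) := contDiff_of_tsupport_subset hU (hf i) (hs i)
  have hint (i : ι) : IntegrableOn (fun x => fderiv ℝ (f i) x (v i)) U μ :=
    (integrable_fderiv_apply (hf' i) (hc i) (v i)).integrableOn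
  rw [integral_add hg (integrable_finsetSum _ fun i _ => hint i),
    integral_finsetSum _ fun i _ => hint i, add_eq_left]
  refine Finset.sum_eq_zero fun i _ => ?_
  rw [setIntegral_eq_integral_of_forall_compl_eq_zero fun x hx => by
    rw [fderiv_of_notMem_tsupport ℝ (mt (@hs i x) hx), zero_apply]]
  exact integral_fderiv_apply_eq_zero (hf' i) (hc i) (v i)

lemma eqOn_zero_of_setIntegral_smul_eq_zero [CompleteSpace F] {f : E → F} {U : Set E}
    (hU : IsOpen U) (hf : ContinuousOn f U)
    (h : ∀ φ : E → ℝ, ContDiff ℝ ∞ φ → HasCompactSupport φ → tsupport φ ⊆ U →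
      ∫ x in U, φ x • f x ∂μ = 0) : Set.EqOn f 0 U := by
  have hae : ∀ᵐ x ∂μ, x ∈ U → f x = 0 := by
    refine hU.ae_eq_zero_of_integral_contDiff_smul_eq_zero
      (hf.locallyIntegrableOn hU.measurableSet) fun φ hφ hc hs => ?_
    rw [← h φ hφ hc hs, setIntegral_eq_integral_of_forall_compl_eq_zero fun x hx => by
      rw [image_eq_zero_of_notMem_tsupport (mt (@hs x) hx), zero_smul]]
  exact Measure.eqOn_open_of_ae_eq ((ae_restrict_iff' hU.measurableSet).2 hae) hU hf
    continuousOn_const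

end VariationalCalculus

section Smoothness

variable {U : Set Form1} {h : Form1 → Form1 →L[ℝ] Form1} {n : WithTop ℕ∞}

lemma contDiffOn_hstar (hh : ContDiffOn ℝ n h U) (hinv : ∀ x ∈ U, (h x).IsInvertible)
    (a : Form1) : ContDiffOn ℝ n (fun x => hstar h x a) U := by
  have hk := contDiffOn_inverse hh hinv
  simp only [hstar, adj, ← mdotL_apply]
  fun_prop

lemma contDiffOn_christoffelLower (hU : IsOpen U) (hh : ContDiffOn ℝ (n + 1) h U)
    {b : Form1 → Form1} (hb : ContDiffOn ℝ n b U) (a c : Form1) :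
    ContDiffOn ℝ n (fun x => christoffelLower h x a (b x) c) U := by
  have hh₀ := hh.of_le le_self_add
  have hdh := hh.fderiv_of_isOpen hU le_rfl
  have hd (x : Form1) (hx : x ∈ U) : DifferentiableAt ℝ h x :=
    (hh.differentiableOn (by simp)).differentiableAt (hU.mem_nhds hx)
  refine ContDiffOn.congr ?_ fun x hx => by
    rw [christoffelLower, fderiv_metric (hd x hx), fderiv_metric (hd x hx),
      fderiv_metric (hd x hx)]
  have hmdot {u v : Form1 → Form1} (hu : ContDiffOn ℝ n u U) (hv : ContDiffOn ℝ n v U) :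
      ContDiffOn ℝ n (fun x => mdot (u x) (v x)) U :=
    (mdotL.contDiff.comp_contDiffOn hu).clm_apply hv
  have hconst (e : Form1) : ContDiffOn ℝ n (fun _ => e) U := contDiffOn_const
  have hmetric {u v w : Form1 → Form1} (hu : ContDiffOn ℝ n u U) (hv : ContDiffOn ℝ n v U)
      (hw : ContDiffOn ℝ n w U) : ContDiffOn ℝ n (fun x =>
        mdot (fderiv ℝ h x (u x) (v x)) (h x (w x)) + mdot (h x (v x)) (fderiv ℝ h x (u x) (w x)))
        U :=
    (hmdot ((hdh.clm_apply hu).clm_apply hv) (hh₀.clm_apply hw)).add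
      (hmdot (hh₀.clm_apply hv) ((hdh.clm_apply hu).clm_apply hw))
  exact contDiffOn_const.mul (((hmetric (hconst a) hb (hconst c)).add
    (hmetric hb (hconst a) (hconst c))).sub (hmetric (hconst c) (hconst a) hb))

lemma contDiffOn_gaugeDeriv_const (hU : IsOpen U) (hh : ContDiffOn ℝ (n + 1) h U)
    (hinv : ∀ x ∈ U, (h x).IsInvertible) (a m : Form1) :
    ContDiffOn ℝ n (gaugeDeriv h a fun _ => m) U := by
  have hh₀ := hh.of_le le_self_add
  have hdh := hh.fderiv_of_isOpen hU le_rfl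
  have hk := contDiffOn_inverse hh₀ hinv
  have hstar_up (μ : Fin 4) := contDiffOn_hstar hh₀ hinv (up μ)
  have hlower (μ : Fin 4) :
      ContDiffOn ℝ n (fun x => christoffelLower h x a ((h x).inverse m) (lo μ)) U :=
    contDiffOn_christoffelLower hU hh (hk.clm_apply contDiffOn_const) a (lo μ)
  refine ContDiffOn.congr ?_ fun x hx => gaugeDeriv_const
    ((hh.differentiableOn (by simp)).differentiableAt (hU.mem_nhds hx)) (hinv x hx) a m
  have hchristoffel : ContDiffOn ℝ n (fun x => christoffel h x a ((h x).inverse m)) U :=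
    ContDiffOn.sum fun μ _ => (hlower μ).smul (hk.clm_apply (hstar_up μ))
  exact (hh₀.clm_apply hchristoffel).sub
    ((hdh.clm_apply contDiffOn_const).clm_apply (hk.clm_apply contDiffOn_const))

lemma contDiffOn_Omega (hU : IsOpen U) (hh : ContDiffOn ℝ (n + 1) h U)
    (hinv : ∀ x ∈ U, (h x).IsInvertible) (a : Form1) :
    ContDiffOn ℝ n (fun x => Omega h x a) U := by
  have hgauge (μ : Fin 4) := contDiffOn_gaugeDeriv_const hU hh hinv a (lo μ)
  simp only [Omega, wedge, ← vecL_apply, ← mulL_apply]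
  fun_prop

lemma contDiffOn_spinorDeriv (hU : IsOpen U) (hh : ContDiffOn ℝ (n + 1) h U)
    (hinv : ∀ x ∈ U, (h x).IsInvertible) {ψ : Form1 → STA} (hψ : ContDiffOn ℝ (n + 1) ψ U) :
    ContDiffOn ℝ n (spinorDeriv h ψ) U := by
  have hψ₀ := hψ.of_le le_self_add
  have hdψ := hψ.fderiv_of_isOpen hU le_rfl
  have hstar_up (μ : Fin 4) := contDiffOn_hstar (hh.of_le le_self_add) hinv (up μ)
  have hOmega (μ : Fin 4) := contDiffOn_Omega hU hh hinv (lo μ)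
  unfold spinorDeriv spinorDirDeriv
  simp only [← vecL_apply, ← mulL_apply]
  fun_prop

lemma contDiffOn_flux (hh : ContDiffOn ℝ n h U) (hinv : ∀ x ∈ U, (h x).IsInvertible)
    {P η : Form1 → STA} (hP : ContDiffOn ℝ n P U) (hη : ContDiffOn ℝ n η U) (μ : Fin 4) :
    ContDiffOn ℝ n (flux h P η μ) U := by
  have hdet : ContDiffOn ℝ n (fun x => (h x).det) U := contDiff_det.comp_contDiffOn hh
  have hstar_up := contDiffOn_hstar hh hinv (up μ)
  unfold flux
  simp only [← vecL_apply, ← mulL_apply]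
  fun_prop

end Smoothness

section Parity

open CliffordAlgebra

lemma Omega_mem_evenPart (h : Form1 → Form1 →L[ℝ] Form1) (x a : Form1) :
    Omega h x a ∈ evenPart := by
  refine Submodule.smul_mem _ _ (Submodule.sum_mem _ fun μ _ => Submodule.smul_mem _ _ ?_)
  exact Submodule.sub_mem _ (ι_mul_ι_mem_evenOdd_zero _ _ _) (ι_mul_ι_mem_evenOdd_zero _ _ _)

lemma spinorDeriv_mem_evenOdd {m k : ZMod 2} (hk : 1 + m = k) (h : Form1 → Form1 →L[ℝ] Form1)
    {ψ : Form1 → STA} (hψ : ∀ x, ψ x ∈ evenOdd minkQ m) (x : Form1) :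
    spinorDeriv h ψ x ∈ evenOdd minkQ k := by
  refine Submodule.sum_mem _ fun μ _ => mul_mem_evenOdd hk (ι_mem_evenOdd_one _ _) ?_
  exact Submodule.add_mem _ (fderiv_apply_mem (Submodule.closed_of_finiteDimensional _) hψ x _)
    (Submodule.smul_mem _ _ (mul_mem_evenOdd (zero_add m) (Omega_mem_evenPart h x _) (hψ x)))

end Parity

section EulerLagrange

open CliffordAlgebra

/-- The field `∂_{𝒟^sψ} ℓ(x, ψ, 𝒟^sψ)` conjugate to the spinor derivative of `ψ`. -/
def momentum (h : Form1 → Form1 →L[ℝ] Form1) (l : Form1 × STA × STA → ℝ) (ψ : Form1 → STA)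
    (x : Form1) : STA :=
  gradOdd (fun Y => l (x, ψ x, Y)) (spinorDeriv h ψ x)

/-- The Euler–Lagrange field `∂_ψ ℓ - 𝒟^s(∂_{𝒟^sψ} ℓ)`. -/
def eulerLagrange (h : Form1 → Form1 →L[ℝ] Form1) (l : Form1 × STA × STA → ℝ)
    (ψ : Form1 → STA) (x : Form1) : STA :=
  gradEven (fun X => l (x, X, spinorDeriv h ψ x)) (ψ x) - spinorDeriv h (momentum h l ψ) x

lemma eulerLagrange_mem_evenPart (h : Form1 → Form1 →L[ℝ] Form1) (l : Form1 × STA × STA → ℝ)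
    (ψ : Form1 → STA) (x : Form1) : eulerLagrange h l ψ x ∈ evenPart :=
  Submodule.sub_mem _ (gradEven_mem_evenPart _ _)
    (spinorDeriv_mem_evenOdd (by decide) h (fun _ => gradOdd_mem_evenOdd_one _ _) x)

variable {U : Set Form1} {h : Form1 → Form1 →L[ℝ] Form1} {l : Form1 × STA × STA → ℝ}
  {ψ η : Form1 → STA} {x : Form1}

lemma tsupport_flux_subset (P : Form1 → STA) (μ : Fin 4) :
    tsupport (flux h P η μ) ⊆ tsupport η :=
  closure_mono fun x hx hη => hx (by rw [flux, hη, map_zero])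

lemma contDiffOn_fderiv_lagrangian (hU : IsOpen U) (hh : ContDiffOn ℝ 2 h U)
    (hinv : ∀ x ∈ U, (h x).IsInvertible) (hψ : ContDiffOn ℝ 2 ψ U)
    (hl : ∀ x ∈ U, ContDiffAt ℝ 2 l (x, ψ x, spinorDeriv h ψ x)) :
    ContDiffOn ℝ 1 (fun x => fderiv ℝ l (x, ψ x, spinorDeriv h ψ x)) U := by
  rw [← one_add_one_eq_two] at hh
  have hD : ContDiffOn ℝ 1 (spinorDeriv h ψ) U :=
    contDiffOn_spinorDeriv hU hh hinv (one_add_one_eq_two (R := WithTop ℕ∞) ▸ hψ)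
  exact contDiffOn_fderiv_comp one_add_one_eq_two.le hl
    (contDiffOn_id.prodMk ((hψ.of_le one_le_two).prodMk hD))

lemma contDiffOn_momentum (hU : IsOpen U) (hh : ContDiffOn ℝ 2 h U)
    (hinv : ∀ x ∈ U, (h x).IsInvertible) (hψ : ContDiffOn ℝ 2 ψ U)
    (hl : ∀ x ∈ U, ContDiffAt ℝ 2 l (x, ψ x, spinorDeriv h ψ x)) :
    ContDiffOn ℝ 1 (momentum h l ψ) U := by
  have hpartial (A : STA) : ContDiffOn ℝ 1
      (fun x => fderiv ℝ (fun Y => l (x, ψ x, Y)) (spinorDeriv h ψ x) A) U :=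
    ((contDiffOn_fderiv_lagrangian hU hh hinv hψ hl).clm_apply contDiffOn_const).congr fun x hx =>
      fderiv_snd_snd_apply ((hl x hx).differentiableAt two_ne_zero) A
  unfold momentum gradOdd
  fun_prop

lemma continuousOn_eulerLagrange (hU : IsOpen U) (hh : ContDiffOn ℝ 2 h U)
    (hinv : ∀ x ∈ U, (h x).IsInvertible) (hψ : ContDiffOn ℝ 2 ψ U)
    (hl : ∀ x ∈ U, ContDiffAt ℝ 2 l (x, ψ x, spinorDeriv h ψ x)) :
    ContinuousOn (eulerLagrange h l ψ) U := by
  have hP : ContDiffOn ℝ (0 + 1) (momentum h l ψ) U := by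
    simpa only [zero_add] using contDiffOn_momentum hU hh hinv hψ hl
  have hpartial (A : STA) : ContinuousOn
      (fun x => fderiv ℝ (fun X => l (x, X, spinorDeriv h ψ x)) (ψ x) A) U :=
    ((contDiffOn_fderiv_lagrangian hU hh hinv hψ hl).continuousOn.clm_apply
      continuousOn_const).congr fun x hx =>
        fderiv_snd_fst_apply ((hl x hx).differentiableAt two_ne_zero) A
  have hgrad : ContinuousOn (fun x => gradEven (fun X => l (x, X, spinorDeriv h ψ x)) (ψ x)) U :=
    continuousOn_finsetSum _ fun I _ => (hpartial (blade I)).smul continuousOn_const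
  exact hgrad.sub (contDiffOn_spinorDeriv hU (hh.of_le (by norm_num)) hinv hP).continuousOn

lemma continuousOn_det_mul_scalarProd_eulerLagrange (hU : IsOpen U) (hh : ContDiffOn ℝ 2 h U)
    (hinv : ∀ x ∈ U, (h x).IsInvertible) (hψ : ContDiffOn ℝ 2 ψ U)
    (hl : ∀ x ∈ U, ContDiffAt ℝ 2 l (x, ψ x, spinorDeriv h ψ x)) (hη : ContinuousOn η U) :
    ContinuousOn (fun x => (h x).det * scalarProd (eulerLagrange h l ψ x) (η x)) U :=
  (contDiff_det.comp_contDiffOn hh).continuousOn.mul ((scalarProd.continuous.comp_continuousOn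
    (continuousOn_eulerLagrange hU hh hinv hψ hl)).clm_apply hη)

lemma variation_eq (hl : DifferentiableAt ℝ l (x, ψ x, spinorDeriv h ψ x))
    (hη : ∀ x, η x ∈ evenPart) :
    variation h l ψ η x = (h x).det
      * (scalarProd (gradEven (fun X => l (x, X, spinorDeriv h ψ x)) (ψ x)) (η x)
        + scalarProd (momentum h l ψ x) (spinorDeriv h η x)) := by
  rw [scalarProd_gradEven _ _ (hη x), momentum,
    scalarProd_gradOdd _ _ (spinorDeriv_mem_evenOdd (add_zero 1) h hη x)]
  exact ((hasDerivAt_comp_add_smul hl _ _).const_mul _).deriv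

lemma variation_eq_add_sum_fderiv_flux (hd : DifferentiableAt ℝ h x) (hi : (h x).IsInvertible)
    (hl : DifferentiableAt ℝ l (x, ψ x, spinorDeriv h ψ x))
    (hP : DifferentiableAt ℝ (momentum h l ψ) x) (hη : DifferentiableAt ℝ η x)
    (hη_even : ∀ x, η x ∈ evenPart) :
    variation h l ψ η x = (h x).det * scalarProd (eulerLagrange h l ψ x) (η x)
      + ∑ μ, fderiv ℝ (flux h (momentum h l ψ) η μ) x (lo μ) := by
  rw [variation_eq hl hη_even, sum_fderiv_flux hd hi hP hη, eulerLagrange, map_sub, sub_apply]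
  ring

lemma setIntegral_variation (hU : IsOpen U) (hh : ContDiffOn ℝ 2 h U)
    (hinv : ∀ x ∈ U, (h x).IsInvertible) (hψ : ContDiffOn ℝ 2 ψ U)
    (hl : ∀ x ∈ U, ContDiffAt ℝ 2 l (x, ψ x, spinorDeriv h ψ x)) (hη : ContDiff ℝ 1 η)
    (hη_even : ∀ x, η x ∈ evenPart) (hc : HasCompactSupport η) (hs : tsupport η ⊆ U) :
    ∫ x in U, variation h l ψ η x
      = ∫ x in U, (h x).det * scalarProd (eulerLagrange h l ψ x) (η x) := by
  have hP := contDiffOn_momentum hU hh hinv hψ hl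
  have hcont := continuousOn_det_mul_scalarProd_eulerLagrange hU hh hinv hψ hl
    hη.continuous.continuousOn
  have hsupport : Function.support (fun x => (h x).det * scalarProd (eulerLagrange h l ψ x) (η x))
      ⊆ Function.support η := fun x hx hx₀ => hx (by simp only [hx₀, map_zero, mul_zero])
  have hcont' := (contDiff_of_tsupport_subset hU (contDiffOn_zero (𝕜 := ℝ).2 hcont)
    ((closure_mono hsupport).trans hs)).continuous
  have hint := (hcont'.integrable_of_hasCompactSupport (μ := volume)
    (hc.mono hsupport)).integrableOn (s := U)
  rw [← setIntegral_add_sum_fderiv_apply hint hU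
    (fun μ => contDiffOn_flux (hh.of_le one_le_two) hinv hP hη.contDiffOn μ)
    (fun μ => hc.mono' (subset_closure.trans (tsupport_flux_subset _ μ)))
    (fun μ => (tsupport_flux_subset _ μ).trans hs) lo]
  exact setIntegral_congr_fun hU.measurableSet fun x hx => variation_eq_add_sum_fderiv_flux
    ((hh.differentiableOn two_ne_zero).differentiableAt (hU.mem_nhds hx)) (hinv x hx)
    ((hl x hx).differentiableAt two_ne_zero)
    ((hP.differentiableOn one_ne_zero).differentiableAt (hU.mem_nhds hx))
    (hη.differentiable one_ne_zero x) hη_even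

lemma StationaryAction.eqOn_det_mul_scalarProd_eulerLagrange (hAP : StationaryAction U h l ψ)
    (hU : IsOpen U) (hh : ContDiffOn ℝ 2 h U) (hinv : ∀ x ∈ U, (h x).IsInvertible)
    (hψ : ContDiffOn ℝ 2 ψ U) (hl : ∀ x ∈ U, ContDiffAt ℝ 2 l (x, ψ x, spinorDeriv h ψ x))
    {B : STA} (hB : B ∈ evenPart) :
    Set.EqOn (fun x => (h x).det * scalarProd (eulerLagrange h l ψ x) B) 0 U := by
  refine eqOn_zero_of_setIntegral_smul_eq_zero (μ := volume) hU
    (continuousOn_det_mul_scalarProd_eulerLagrange hU hh hinv hψ hl continuousOn_const)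
    fun φ hφ hc hs => ?_
  have heven (x : Form1) : φ x • B ∈ evenPart := Submodule.smul_mem _ _ hB
  have hη : ContDiff ℝ ∞ fun x => φ x • B := hφ.smul contDiff_const
  have hfrontier (x : Form1) (hx : x ∈ frontier U) : φ x • B = 0 := by
    rw [image_eq_zero_of_notMem_tsupport (f := φ) fun hxs => (hU.frontier_eq ▸ hx).2 (hs hxs),
      zero_smul]
  have hstationary := hAP _ hη hc.smul_right heven hfrontier
  rw [setIntegral_variation hU hh hinv hψ hl (hη.of_le (by simp)) heven hc.smul_right
    ((tsupport_smul_subset_left φ _).trans hs)] at hstationary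
  simpa only [map_smul, smul_eq_mul, mul_left_comm] using hstationary

end EulerLagrange

end GaugeSpinor

end

open GaugeSpinor in
theorem mainTheorem3_general (U : Set Form1) (hU : IsOpen U)
    (h : Form1 → Form1 →L[ℝ] Form1) (hh : ContDiffOn ℝ 2 h U)
    (hinv : ∀ x ∈ U, (h x).IsInvertible) (ψ : Form1 → STA) (hψ : ContDiffOn ℝ 2 ψ U)
    (l : Form1 × STA × STA → ℝ)
    (hl : ∀ x ∈ U, ContDiffAt ℝ 2 l (x, ψ x, spinorDeriv h ψ x))
    (hAP : StationaryAction U h l ψ) :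
    ∀ x ∈ U, gradEven (fun X => l (x, X, spinorDeriv h ψ x)) (ψ x)
      - spinorDeriv h (fun y => gradOdd (fun Y => l (y, ψ y, Y)) (spinorDeriv h ψ y)) x = 0 := by
  intro x hx
  refine eq_zero_of_forall_scalarProd_eq_zero (eulerLagrange_mem_evenPart h l ψ x) fun B hB => ?_
  have hpair := hAP.eqOn_det_mul_scalarProd_eulerLagrange hU hh hinv hψ hl hB hx
  exact (mul_eq_zero.1 hpair).resolve_left (det_ne_zero_of_isInvertible (hinv x hx))

theorem mainTheorem3 (U : Set GaugeSpinor.Form1) (hU : IsOpen U)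
    (h : GaugeSpinor.Form1 → GaugeSpinor.Form1 →L[ℝ] GaugeSpinor.Form1)
    (hh : ContDiffOn ℝ ∞ h U) (hinv : ∀ x ∈ U, (h x).IsInvertible)
    (ψ : GaugeSpinor.Form1 → GaugeSpinor.STA)
    (hψ : ContDiffOn ℝ ∞ ψ U) (hψe : ∀ x ∈ U, ψ x ∈ GaugeSpinor.evenPart)
    (l : GaugeSpinor.Form1 × GaugeSpinor.STA × GaugeSpinor.STA → ℝ)
    (hl : ∀ x ∈ U, ContDiffAt ℝ 2 l (x, ψ x, GaugeSpinor.spinorDeriv h ψ x))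
    (hAP : GaugeSpinor.StationaryAction U h l ψ) :
    ∀ x ∈ U,
      GaugeSpinor.gradEven (fun X => l (x, X, GaugeSpinor.spinorDeriv h ψ x)) (ψ x)
        - GaugeSpinor.spinorDeriv h
            (fun y => GaugeSpinor.gradOdd (fun Y => l (y, ψ y, Y)) (GaugeSpinor.spinorDeriv h ψ y))
            x = 0 := by
  have hle : (2 : WithTop ℕ∞) ≤ ∞ := by norm_cast
  exact mainTheorem3_general U hU h (hh.of_le hle) hinv ψ (hψ.of_le hle) l hl hAP
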